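/- Theorem 4.2. Let $\mathbb{F}$ be an arbitrary field. A left Leibniz algebra $\mathfrak{L}$ over $\mathbb{F}$ is a vector space with a bilinear product satisfying $x(yz)=(xy)z+y(xz)$; it is nilpotent if there is a positive integer $n$ such that every product of $n$ elements of $\mathfrak{L}$, no matter how associated, is zero. An $\mathfrak{L}$-bimodule is a vector space $M$ with bilinear left and right actions such that, for all $x,y\in\mathfrak{L}$ and $m\in M$, $$(xy)\cdot m=x\cdot(y\cdot m)-y\cdot(x\cdot m),\quad (x\cdot m)\cdot y=x\cdot(m\cdot y)-m\cdot(xy),\quad (m\cdot x)\cdot y=m\cdot(xy)-x\cdot(m\cdot y).$$ It is called trivial if $x\cdot m=0=m\cdot x$ for all $x,m$, and symmetric if $m\cdot x=-x\cdot m$ for all $x,m$. Its anti-symmetric kernel $M_0$ is the subspace spanned by all elements $x\cdot m+m\cdot x$. Let $\mathrm{HL}^n(\mathfrak{L},M)=\mathrm{Ker}(\mathrm{d}^n)/\mathrm{Im}(\mathrm{d}^{n-1})$ (with $\mathrm{d}^{-1}=0$) be the cohomology of the cochain complex $\mathrm{CL}^n(\mathfrak{L},M)=\mathrm{Hom}_{\mathbb{F}}(\mathfrak{L}^{\otimes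 n},M)$, $n\ge 0$, with $$(\mathrm{d}^nf)(x_1\otimes\cdots\otimes x_{n+1})=\sum_{j=1}^n(-1)^{j+1}x_j\cdot f(x_1\otimes\cdots\otimes\hat{x}_j\otimes\cdots\otimes x_{n+1})+(-1)^{n+1}f(x_1\otimes\cdots\otimes x_n)\cdot x_{n+1}$$ $$+\sum_{1\le i<j\le n+1}(-1)^if(x_1\otimes\cdots\otimes\hat{x}_i\otimes\cdots\otimes x_{j-1}\otimes x_ix_j\otimes x_{j+1}\otimes\cdots\otimes x_{n+1}).$$ Let $\mathfrak{L}$ be a finite-dimensional nilpotent left Leibniz algebra over $\mathbb{F}$, and let $M$ be a finite-dimensional $\mathfrak{L}$-bimodule such that every composition factor of $M$ (as a bimodule) is non-trivial. Then, as $\mathbb{F}$-vector spaces, $\mathrm{HL}^0(\mathfrak{L},M)\cong M_0$, and $\mathrm{HL}^n(\mathfrak{L},M)=0$ for every integer $n\ge 1$. Moreover, if in addition $M$ is symmetric, then $\mathrm{HL}^n(\mathfrak{L},M)=0$ for every integer $n\ge 0$. -/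

import Mathlib

/-- A (not necessarily associative or unital) algebra is a left Leibniz algebra if every left
multiplication operator `y ↦ x * y` is a derivation. -/
class IsLeftLeibniz (L : Type*) [NonUnitalNonAssocRing L] : Prop where
  leibniz : ∀ x y z : L, x * (y * z) = (x * y) * z + y * (x * z)

/-- An algebra is nilpotent if for some positive integer `n` every product of `n` elements, no
matter how associated, is zero. A product of `n` elements with a choice of parentheses is an
element of length `n` of the free magma, evaluated by `FreeMagma.lift id`. -/
def IsNilpotentAlgebra (L : Type*) [NonUnitalNonAssocRing L] : Prop :=
  ∃ n : ℕ, 0 < n ∧ ∀ w : FreeMagma L, w.length = n → FreeMagma.lift (id : L → L) w = 0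

/-- A bimodule structure over the left Leibniz algebra `L` on the vector space `M`:
`left x m` is `x · m` and `right x m` is `m · x`. -/
structure LeibnizBimodule (F L M : Type*) [Field F] [NonUnitalNonAssocRing L] [Module F L]
    [AddCommGroup M] [Module F M] where
  left : L →ₗ[F] M →ₗ[F] M
  right : L →ₗ[F] M →ₗ[F] M
  /-- `(xy) · m = x · (y · m) - y · (x · m)` -/
  llm : ∀ (x y : L) (m : M), left (x * y) m = left x (left y m) - left y (left x m)
  /-- `(x · m) · y = x · (m · y) - m · (xy)` -/
  lml : ∀ (x y : L) (m : M), right y (left x m) = left x (right y m) - right (x * y) m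
  /-- `(m · x) · y = m · (xy) - x · (m · y)` -/
  mll : ∀ (x y : L) (m : M), right y (right x m) = right (x * y) m - left x (right y m)

namespace LeibnizBimodule

section Bimodule

variable {F L M : Type*} [Field F] [NonUnitalNonAssocRing L] [Module F L]
  [AddCommGroup M] [Module F M] (B : LeibnizBimodule F L M)

/-- `m · x = - x · m` for all `x` and `m`. -/
def IsSymmetric : Prop := ∀ (x : L) (m : M), B.right x m = -B.left x m

/-- `x · m = 0 = m · x` for all `x` and `m`. -/
def IsTrivial : Prop := ∀ (x : L) (m : M), B.left x m = 0 ∧ B.right x m = 0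

/-- The anti-symmetric kernel `M₀`, spanned by all `x · m + m · x`. -/
def antisymmetricKernel : Submodule F M :=
  Submodule.span F {v : M | ∃ (x : L) (m : M), v = B.left x m + B.right x m}

/-- A subbimodule is a subspace invariant under the left and the right action. -/
def IsSubbimodule (N : Submodule F M) : Prop :=
  ∀ (x : L), ∀ m ∈ N, B.left x m ∈ N ∧ B.right x m ∈ N

/-- The lattice of subbimodules, with intersection and sum of subspaces. -/
def subbimodules : Sublattice (Submodule F M) where
  carrier := {N | B.IsSubbimodule N}
  supClosed' := by
    intro N₁ h₁ N₂ h₂ x m hm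
    obtain ⟨a, ha, b, hb, rfl⟩ := Submodule.mem_sup.1 hm
    rw [map_add, map_add]
    exact ⟨Submodule.add_mem_sup (h₁ x a ha).1 (h₂ x b hb).1,
      Submodule.add_mem_sup (h₁ x a ha).2 (h₂ x b hb).2⟩
  infClosed' := by
    intro N₁ h₁ N₂ h₂ x m hm
    exact ⟨⟨(h₁ x m hm.1).1, (h₂ x m hm.2).1⟩, ⟨(h₁ x m hm.1).2, (h₂ x m hm.2).2⟩⟩

instance : IsModularLattice B.subbimodules where
  sup_inf_le_assoc_of_le {a} b {c} hac :=
    IsModularLattice.sup_inf_le_assoc_of_le (α := Submodule F M) (x := a) (b : Submodule F M)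
      (z := c) hac

/-- A subbimodule with the restricted actions. -/
def restrict {N : Submodule F M} (hN : B.IsSubbimodule N) : LeibnizBimodule F L N where
  left :=
    { toFun := fun x => (B.left x).restrict fun m hm => (hN x m hm).1
      map_add' := fun x y => by ext m; simp
      map_smul' := fun c x => by ext m; simp }
  right :=
    { toFun := fun x => (B.right x).restrict fun m hm => (hN x m hm).2
      map_add' := fun x y => by ext m; simp
      map_smul' := fun c x => by ext m; simp }
  llm x y m := Subtype.ext (B.llm x y m)
  lml x y m := Subtype.ext (B.lml x y m)
  mll x y m := Subtype.ext (B.mll x y m)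

/-- The quotient by a subbimodule with the induced actions. -/
def quotient {N : Submodule F M} (hN : B.IsSubbimodule N) : LeibnizBimodule F L (M ⧸ N) where
  left :=
    { toFun := fun x => N.mapQ N (B.left x) fun m hm => (hN x m hm).1
      map_add' := fun x y => by ext m; simp
      map_smul' := fun c x => by ext m; simp }
  right :=
    { toFun := fun x => N.mapQ N (B.right x) fun m hm => (hN x m hm).2
      map_add' := fun x y => by ext m; simp
      map_smul' := fun c x => by ext m; simp }
  llm x y m := by
    obtain ⟨m, rfl⟩ := N.mkQ_surjective m
    exact congrArg N.mkQ (B.llm x y m)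
  lml x y m := by
    obtain ⟨m, rfl⟩ := N.mkQ_surjective m
    exact congrArg N.mkQ (B.lml x y m)
  mll x y m := by
    obtain ⟨m, rfl⟩ := N.mkQ_surjective m
    exact congrArg N.mkQ (B.mll x y m)

/-- The bimodule `N₂ / N₁` for subbimodules `N₁ ≤ N₂` (in general `N₂ / (N₁ ∩ N₂)`). -/
def subquotient (N₁ N₂ : B.subbimodules) :
    LeibnizBimodule F L
      ((N₂ : Submodule F M) ⧸ (N₁ : Submodule F M).submoduleOf (N₂ : Submodule F M)) :=
  (B.restrict N₂.2).quotient fun x m hm => N₁.2 x m hm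

/-- Every composition factor of `M` is non-trivial: in every composition series
`0 = N₀ < N₁ < ⋯ < Nₖ = M` of subbimodules, each one maximal in the next, all the factors
`Nᵢ₊₁ / Nᵢ` are non-trivial bimodules. -/
def CompositionFactorsNontrivial : Prop :=
  ∀ s : CompositionSeries B.subbimodules,
    (s.head : Submodule F M) = ⊥ → (s.last : Submodule F M) = ⊤ →
      ∀ i : Fin s.length, ¬ (B.subquotient (s i.castSucc) (s i.succ)).IsTrivial

end Bimodule

section Cohomology

variable {F L M : Type*} [Field F] [NonUnitalNonAssocRing L] [Module F L] [IsScalarTower F L L]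
  [SMulCommClass F L L] [AddCommGroup M] [Module F M]

/-- The cochains `CLⁿ(L, M) = Hom(L ⊗ ⋯ ⊗ L, M)`, as `n`-linear maps. -/
abbrev Cochain (F L M : Type*) [Field F] [NonUnitalNonAssocRing L] [Module F L]
    [AddCommGroup M] [Module F M] (n : ℕ) : Type _ :=
  MultilinearMap F (fun _ : Fin n => L) M

/-- `(x₀, …, xₙ) ↦ g xₖ (f (x₀, …, x̂ₖ, …, xₙ))` -/
def actTerm {n : ℕ} (g : L →ₗ[F] M →ₗ[F] M) (f : Cochain F L M n) (k : Fin (n + 1)) :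
    Cochain F L M (n + 1) where
  toFun x := g (x k) (f (k.removeNth x))
  map_update_add' := by
    intro inst x j a b
    obtain rfl := Subsingleton.elim inst (instDecidableEqFin _)
    rcases Fin.eq_self_or_eq_succAbove k j with rfl | ⟨j, rfl⟩
    · simp
    · simp
  map_update_smul' := by
    intro inst x j c a
    obtain rfl := Subsingleton.elim inst (instDecidableEqFin _)
    rcases Fin.eq_self_or_eq_succAbove k j with rfl | ⟨j, rfl⟩
    · simp
    · simp

/-- `(x₀, …, xₙ) ↦ f (x₀, …, x̂ᵢ, …, xᵢ * xⱼ, …, xₙ)`, where the entry `xᵢ` is removed and the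
entry `xⱼ` is replaced by `xᵢ * xⱼ`. -/
def mulTerm {n : ℕ} (f : Cochain F L M n) (i j : Fin (n + 1)) (hij : i < j) :
    Cochain F L M (n + 1) where
  toFun x := f (i.removeNth (Function.update x j (x i * x j)))
  map_update_add' := by
    intro inst x k a b
    obtain rfl := Subsingleton.elim inst (instDecidableEqFin _)
    obtain ⟨j, rfl⟩ := Fin.exists_succAbove_eq hij.ne'
    rcases Fin.eq_self_or_eq_succAbove i k with rfl | ⟨k, rfl⟩
    · simp [add_mul]
    · rcases eq_or_ne k j with rfl | hkj
      · simp [mul_add, Fin.ne_succAbove]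
      · have h : i.succAbove k ≠ i.succAbove j := fun h => hkj (Fin.succAbove_right_injective h)
        simp [Fin.ne_succAbove, Function.update_comm hkj, Function.update_of_ne h.symm]
  map_update_smul' := by
    intro inst x k c a
    obtain rfl := Subsingleton.elim inst (instDecidableEqFin _)
    obtain ⟨j, rfl⟩ := Fin.exists_succAbove_eq hij.ne'
    rcases Fin.eq_self_or_eq_succAbove i k with rfl | ⟨k, rfl⟩
    · simp [smul_mul_assoc]
    · rcases eq_or_ne k j with rfl | hkj
      · simp [mul_smul_comm, Fin.ne_succAbove]
      · have h : i.succAbove k ≠ i.succAbove j := fun h => hkj (Fin.succAbove_right_injective h)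
        simp [Fin.ne_succAbove, Function.update_comm hkj, Function.update_of_ne h.symm]

/-- The Leibniz coboundary `dⁿ : CLⁿ(L, M) → CLⁿ⁺¹(L, M)`. The arguments `x₁, …, xₙ₊₁` of the usual
formula are numbered from `0` to `n` here, which shifts the exponents of `-1` by one. -/
def d (B : LeibnizBimodule F L M) (n : ℕ) : Cochain F L M n →ₗ[F] Cochain F L M (n + 1) where
  toFun f :=
    (∑ j : Fin n, (-1 : F) ^ (j : ℕ) • actTerm B.left f j.castSucc)
      + (-1 : F) ^ (n + 1) • actTerm B.right f (Fin.last n)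
      + ∑ i : Fin (n + 1), ∑ j : Fin (n + 1),
          if hij : i < j then (-1 : F) ^ ((i : ℕ) + 1) • mulTerm f i j hij else 0
  map_add' f g := by
    have h₁ : ∀ (a : L →ₗ[F] M →ₗ[F] M) k,
        actTerm a (f + g) k = actTerm a f k + actTerm a g k := fun a k => by
      ext x; simp [actTerm]
    have h₂ : ∀ i j (hij : i < j), mulTerm (f + g) i j hij = mulTerm f i j hij + mulTerm g i j hij :=
      fun i j hij => by ext x; simp [mulTerm]
    have h₃ : ∀ i j : Fin (n + 1),
        (if hij : i < j then (-1 : F) ^ ((i : ℕ) + 1) • mulTerm (f + g) i j hij else 0)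
          = (if hij : i < j then (-1 : F) ^ ((i : ℕ) + 1) • mulTerm f i j hij else 0)
            + (if hij : i < j then (-1 : F) ^ ((i : ℕ) + 1) • mulTerm g i j hij else 0) := by
      intro i j
      split_ifs with hij
      · rw [h₂, smul_add]
      · simp
    simp only [h₁, h₃, smul_add, Finset.sum_add_distrib]
    abel
  map_smul' c f := by
    have h₁ : ∀ (a : L →ₗ[F] M →ₗ[F] M) k, actTerm a (c • f) k = c • actTerm a f k :=
      fun a k => by ext x; simp [actTerm]
    have h₃ : ∀ i j : Fin (n + 1),
        (if hij : i < j then (-1 : F) ^ ((i : ℕ) + 1) • mulTerm (c • f) i j hij else 0)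
          = c • (if hij : i < j then (-1 : F) ^ ((i : ℕ) + 1) • mulTerm f i j hij else 0) := by
      intro i j
      split_ifs with hij
      · rw [smul_comm]; congr 1
      · simp
    simp only [h₁, h₃, smul_add, Finset.smul_sum, RingHom.id_apply, smul_comm c]

/-- The coboundary written out, `(-1)ʲ xⱼ · f(…)`, `(-1)ⁿ⁺¹ f(…) · xₙ` and `(-1)ⁱ⁺¹ f(…, xᵢ xⱼ, …)`. -/
theorem d_apply (B : LeibnizBimodule F L M) (n : ℕ) (f : Cochain F L M n) (x : Fin (n + 1) → L) :
    B.d n f x =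
      (∑ j : Fin n, (-1 : F) ^ (j : ℕ) • B.left (x j.castSucc) (f (j.castSucc.removeNth x)))
        + (-1 : F) ^ (n + 1) • B.right (x (Fin.last n)) (f ((Fin.last n).removeNth x))
        + ∑ i : Fin (n + 1), ∑ j : Fin (n + 1),
            if i < j then
              (-1 : F) ^ ((i : ℕ) + 1) • f (i.removeNth (Function.update x j (x i * x j)))
            else 0 := by
  have h : ∀ i j : Fin (n + 1),
      (if hij : i < j then (-1 : F) ^ ((i : ℕ) + 1) • mulTerm f i j hij else 0) x
        = if i < j then
            (-1 : F) ^ ((i : ℕ) + 1) • f (i.removeNth (Function.update x j (x i * x j)))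
          else 0 := by
    intro i j
    split_ifs <;> rfl
  simp only [d, LinearMap.coe_mk, AddHom.coe_mk, add_apply,
    sum_apply, h]
  rfl

/-- The cocycles `ZLⁿ(L, M) = Ker dⁿ`. -/
def cocycles (B : LeibnizBimodule F L M) (n : ℕ) : Submodule F (Cochain F L M n) :=
  LinearMap.ker (B.d n)

/-- The coboundaries `BLⁿ(L, M) = Im dⁿ⁻¹`, with `d⁻¹ = 0`. -/
def coboundaries (B : LeibnizBimodule F L M) : (n : ℕ) → Submodule F (Cochain F L M n)
  | 0 => ⊥
  | n + 1 => LinearMap.range (B.d n)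

/-- The Leibniz cohomology `HLⁿ(L, M) = ZLⁿ(L, M) / BLⁿ(L, M)`. Here `BLⁿ(L, M)` is seen as a
subspace of `ZLⁿ(L, M)` (it is contained in it, as `dⁿ ∘ dⁿ⁻¹ = 0` over a left Leibniz algebra). -/
abbrev HL (B : LeibnizBimodule F L M) (n : ℕ) : Type _ :=
  B.cocycles n ⧸ (B.coboundaries n).submoduleOf (B.cocycles n)

end Cohomology

end LeibnizBimodule

/-!
Left multiplications act on the cochain complex by Lie derivatives `θₓ`, and contraction with `x` in
the first argument is a homotopy between `θₓ` and `0` in positive degrees: `ιₓ d = θₓ - d ιₓ`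
(`contract_d`). Hence `θₓ` maps the cocycles of positive degree into the coboundaries. In degree `0`
the cocycles are the `m` with `m · x = 0` for all `x`, and `θₓ` maps such an `m` to
`x · m = x · m + m · x`, an element of the anti-symmetric kernel `M₀`. As `M₀` consists of cocycles,
everything follows once the cocycles are known to be contained in every space into which all `θₓ` map
them (`le_of_lieDeriv_mem`).

If one `θₓ` were invertible on the cocycles this would be immediate. In general there is such an `x`
for each composition factor. A non-trivial irreducible bimodule is symmetric or anti-symmetric, so by
Engel's theorem some left action on it is not nilpotent; its generalized null space is a subbimodule,
because left multiplications are nilpotent on `L`, and therefore it is zero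
(`exists_injective_left_of_irreducible`). Nilpotency of left multiplication by `x` also implies that
generalized null vectors of `θₓ` take values in generalized null vectors of the left action of `x`
(`exists_left_pow_apply_eq_zero`). So Fitting's decomposition for `θₓ` moves a cocycle with values in
one term of a composition series, modulo the image of `θₓ`, to a cocycle with values in the preceding
term.
-/

/-! ### The Lie derivative and Cartan's formulas -/

namespace LeibnizBimodule

section Cartan

variable {F L M : Type*} [Field F] [NonUnitalNonAssocRing L] [Module F L]
  [AddCommGroup M] [Module F M]

/-- The contraction `f ↦ f (y, ·, …, ·)`, linear in `y` and in `f`. -/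
def contract (n : ℕ) : L →ₗ[F] Cochain F L M (n + 1) →ₗ[F] Cochain F L M n :=
  (multilinearCurryLeftEquiv F (fun _ : Fin (n + 1) => L) M).toLinearMap.flip

@[simp]
theorem contract_apply {n : ℕ} (y : L) (f : Cochain F L M (n + 1)) (v : Fin n → L) :
    contract n y f v = f (Fin.cons y v) := rfl

theorem cochain_ext_contract {n : ℕ} {f g : Cochain F L M (n + 1)}
    (h : ∀ y : L, contract n y f = contract n y g) : f = g := by
  ext v
  rw [← Fin.cons_self_tail v]
  exact congrArg (fun e : Cochain F L M n => e (Fin.tail v)) (h (v 0))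

variable [SMulCommClass F L L]

/-- The Lie derivative `θₓ` on cochains,
`(θₓ f)(y₁, …, yₙ) = x · f (y₁, …, yₙ) - ∑ⱼ f (y₁, …, x yⱼ, …, yₙ)`,
given by recursion on `n` through `(θₓ f)(y, …) = θₓ (f (y, …)) - f (xy, …)`. Only the left action
on the coefficients enters. -/
def lieDeriv (B : LeibnizBimodule F L M) (x : L) :
    (n : ℕ) → Cochain F L M n →ₗ[F] Cochain F L M n
  | 0 => LinearMap.compMultilinearMapₗ F (B.left x)
  | n + 1 =>
    let e := multilinearCurryLeftEquiv F (fun _ : Fin (n + 1) => L) M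
    e.symm.toLinearMap ∘ₗ
      (LinearMap.compRight F (lieDeriv B x n) - LinearMap.lcomp F _ (LinearMap.mulLeft F x)) ∘ₗ
      e.toLinearMap

variable (B : LeibnizBimodule F L M)

theorem lieDeriv_zero_apply (x : L) (f : Cochain F L M 0) (v : Fin 0 → L) :
    B.lieDeriv x 0 f v = B.left x (f v) := rfl

theorem contract_lieDeriv {n : ℕ} (x y : L) (f : Cochain F L M (n + 1)) :
    contract n y (B.lieDeriv x (n + 1) f) =
      B.lieDeriv x n (contract n y f) - contract n (x * y) f := by
  ext v
  rfl

theorem lieDeriv_apply {n : ℕ} (x : L) (f : Cochain F L M n) (v : Fin n → L) :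
    B.lieDeriv x n f v =
      B.left x (f v) - ∑ j : Fin n, f (Function.update v j (x * v j)) := by
  induction n with
  | zero => simp [lieDeriv_zero_apply]
  | succ n ih =>
    obtain ⟨y, w, rfl⟩ : ∃ y w, v = Fin.cons y w := ⟨_, _, (Fin.cons_self_tail v).symm⟩
    have h := congrArg (fun e : Cochain F L M n => e w) (B.contract_lieDeriv x y f)
    simp only [contract_apply, sub_apply, ih] at h
    rw [h, Fin.sum_univ_succ, sub_sub, add_comm (∑ _, _)]
    simp [Fin.cons_update]

/-- The Lie derivatives represent the Lie algebra of left multiplications. -/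
theorem lieDeriv_mul [IsLeftLeibniz L] {n : ℕ} (x y : L) (f : Cochain F L M n) :
    B.lieDeriv (x * y) n f =
      B.lieDeriv x n (B.lieDeriv y n f) - B.lieDeriv y n (B.lieDeriv x n f) := by
  induction n with
  | zero => ext v; exact B.llm x y (f v)
  | succ n ih =>
    refine cochain_ext_contract fun z => ?_
    have hz := IsLeftLeibniz.leibniz x y z
    simp only [contract_lieDeriv, map_sub, ih, hz, map_add, LinearMap.add_apply]
    abel

variable [IsScalarTower F L L]

/-- Cartan's formula `ιₓ d = θₓ - d ιₓ`. It fails on `0`-cochains, where `ιₓ d` is the right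
action of `x` up to sign. -/
theorem contract_d {n : ℕ} (x : L) (f : Cochain F L M (n + 1)) :
    contract (n + 1) x (B.d (n + 1) f) =
      B.lieDeriv x (n + 1) f - B.d n (contract n x f) := by
  have hrem : ∀ (k : Fin (n + 1)) (v : Fin (n + 1) → L),
      k.succ.removeNth (Fin.cons x v : Fin (n + 2) → L) = Fin.cons x (k.removeNth v) := by
    intro k v
    ext i
    refine Fin.cases ?_ (fun i => ?_) i <;> simp [Fin.removeNth]
  ext v
  rw [contract_apply, sub_apply, lieDeriv_apply, d_apply, d_apply]
  rw [Fin.sum_univ_succ, Fin.sum_univ_succ (n := n + 1)]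
  simp only [Fin.castSucc_zero, Fin.cons_zero, Fin.removeNth_zero, Fin.tail_cons, Fin.val_zero,
    pow_zero, one_smul, ← Fin.succ_castSucc, ← Fin.succ_last, Fin.cons_succ, hrem, contract_apply,
    Fin.val_succ, Fin.sum_univ_succ (n := n + 1), Fin.succ_lt_succ_iff, Fin.succ_pos,
    ← Fin.cons_update, if_true, lt_irrefl, if_false, zero_add, Fin.not_lt_zero,
    pow_succ, mul_neg, mul_one, neg_smul, neg_neg, Finset.sum_neg_distrib]
  have h2 : ∀ (a : Fin (n + 1) → Fin (n + 1) → F) (b : Fin (n + 1) → Fin (n + 1) → M),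
      (∑ i, ∑ j, if i < j then -(a i j • b i j) else 0) =
        -∑ i, ∑ j, if i < j then a i j • b i j else 0 := by
    intro a b
    simp only [← Finset.sum_neg_distrib]
    refine Finset.sum_congr rfl fun i _ => Finset.sum_congr rfl fun j _ => ?_
    split_ifs <;> simp
  simp only [h2]
  abel

/-- The Lie derivative is a cochain map. -/
theorem d_lieDeriv [IsLeftLeibniz L] {n : ℕ} (x : L) (f : Cochain F L M n) :
    B.d n (B.lieDeriv x n f) = B.lieDeriv x (n + 1) (B.d n f) := by
  induction n with
  | zero =>
    refine cochain_ext_contract fun y => ?_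
    rw [contract_lieDeriv]
    ext v
    obtain ⟨m, hm⟩ : ∃ m, ∀ w, f w = m := ⟨f 0, fun w => congrArg f (Subsingleton.elim _ _)⟩
    simp [d_apply, lieDeriv_zero_apply, hm, B.lml x y m]
    abel
  | succ n ih =>
    refine cochain_ext_contract fun y => ?_
    simp only [contract_lieDeriv, contract_d, map_sub, ih, lieDeriv_mul]
    abel

/-- The Lie derivative maps a cocycle of positive degree to the coboundary of its contraction. -/
theorem lieDeriv_mem_coboundaries {n : ℕ} (x : L) {f : Cochain F L M (n + 1)}
    (hf : f ∈ B.cocycles (n + 1)) : B.lieDeriv x (n + 1) f ∈ B.coboundaries (n + 1) := by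
  have h := B.contract_d x f
  rw [LinearMap.mem_ker.1 hf, map_zero] at h
  exact ⟨contract n x f, (sub_eq_zero.1 h.symm).symm⟩

theorem lieDeriv_mem_cocycles [IsLeftLeibniz L] {n : ℕ} (x : L) {f : Cochain F L M n}
    (hf : f ∈ B.cocycles n) : B.lieDeriv x n f ∈ B.cocycles n :=
  LinearMap.mem_ker.2 (by rw [d_lieDeriv, LinearMap.mem_ker.1 hf, map_zero])

end Cartan

/-! ### Fitting's lemma -/

section Fitting

variable {F : Type*} [Field F]

/-- If the operators `S`, `T`, `R` are compatible with a bilinear map `b` as derivations are, then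
`b` maps generalized null vectors of `S` and `T` to generalized null vectors of `R`. -/
theorem pow_apply_bilin_eq_zero {U V W : Type*} [AddCommGroup U] [Module F U] [AddCommGroup V]
    [Module F V] [AddCommGroup W] [Module F W] {S : Module.End F U} {T : Module.End F V}
    {R : Module.End F W} (b : U →ₗ[F] V →ₗ[F] W)
    (h : ∀ u v, R (b u v) = b (S u) v + b u (T v)) {j k : ℕ} {u : U} {v : V}
    (hu : (S ^ j) u = 0) (hv : (T ^ k) v = 0) : (R ^ (j + k)) (b u v) = 0 := by
  induction j generalizing k u v with
  | zero => simp [show u = 0 from hu]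
  | succ j ihj =>
    induction k generalizing u v with
    | zero => simp [show v = 0 from hv]
    | succ k ihk =>
      rw [← add_assoc, pow_succ, Module.End.mul_apply, h, map_add,
        ihk hu (by simpa [pow_succ] using hv), add_zero, add_right_comm]
      exact ihj (by simpa [pow_succ] using hu) hv

/-- A vector in a `T`-invariant subspace is, up to an element of the image of that subspace, a
generalized null vector of `T`. This is Fitting's decomposition of the subspace. -/
theorem exists_pow_apply_sub_eq_zero {V : Type*} [AddCommGroup V] [Module F V]
    [FiniteDimensional F V] (T : Module.End F V) {Z : Submodule F V} (hZ : ∀ z ∈ Z, T z ∈ Z)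
    {z : V} (hz : z ∈ Z) : ∃ w ∈ Z, ∃ k : ℕ, (T ^ k) (z - T w) = 0 := by
  obtain ⟨k, hk⟩ :=
    Filter.eventually_atTop.1 (LinearMap.eventually_isCompl_ker_pow_range_pow (T.restrict hZ))
  have hmem : (⟨z, hz⟩ : Z) ∈ (⊤ : Submodule F Z) := trivial
  rw [← (hk (k + 1) k.le_succ).sup_eq_top] at hmem
  obtain ⟨a, ha, _, ⟨c, rfl⟩, hac⟩ := Submodule.mem_sup.1 hmem
  refine ⟨((T.restrict hZ) ^ k) c, Subtype.prop _, k + 1, ?_⟩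
  rw [LinearMap.mem_ker, Module.End.pow_restrict] at ha
  have ha' : (T ^ (k + 1)) a = 0 := congrArg Subtype.val ha
  have hza : (a : V) = z - T ((((T.restrict hZ) ^ k) c : Z) : V) := by
    rw [eq_sub_iff_add_eq]
    have := congrArg Subtype.val hac
    rwa [pow_succ', Module.End.mul_apply] at this
  rwa [← hza]

end Fitting

/-! ### The anti-symmetric kernel -/

section AntisymmetricKernel

variable {F L M : Type*} [Field F] [NonUnitalNonAssocRing L] [Module F L]
  [AddCommGroup M] [Module F M] (B : LeibnizBimodule F L M)

theorem left_add_right_mem_antisymmetricKernel (x : L) (m : M) :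
    B.left x m + B.right x m ∈ B.antisymmetricKernel :=
  Submodule.subset_span ⟨x, m, rfl⟩

/-- The anti-symmetric kernel is an anti-symmetric bimodule: its right action vanishes. -/
theorem right_eq_zero_of_mem_antisymmetricKernel (y : L) {m : M}
    (hm : m ∈ B.antisymmetricKernel) : B.right y m = 0 := by
  suffices h : B.antisymmetricKernel ≤ LinearMap.ker (B.right y) from h hm
  rw [antisymmetricKernel, Submodule.span_le]
  rintro _ ⟨x, m, rfl⟩
  simp [B.lml, B.mll]

theorem isSubbimodule_antisymmetricKernel : B.IsSubbimodule B.antisymmetricKernel := by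
  intro x m hm
  have h := B.left_add_right_mem_antisymmetricKernel x m
  rw [B.right_eq_zero_of_mem_antisymmetricKernel x hm] at h ⊢
  exact ⟨by simpa using h, zero_mem _⟩

theorem IsSymmetric.antisymmetricKernel_eq_bot {B : LeibnizBimodule F L M} (hB : B.IsSymmetric) :
    B.antisymmetricKernel = ⊥ := by
  rw [antisymmetricKernel, Submodule.span_eq_bot]
  rintro _ ⟨x, m, rfl⟩
  simp [hB x m]

end AntisymmetricKernel

/-! ### Irreducible bimodules -/

section Irreducible

variable {F L M : Type*} [Field F] [NonUnitalNonAssocRing L] [Module F L]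
  [AddCommGroup M] [Module F M] (B : LeibnizBimodule F L M)

/-- The generalized null space of the left action of `x`. -/
def leftFittingNull (x : L) : Submodule F M := ⨆ k : ℕ, LinearMap.ker (B.left x ^ k)

theorem mem_leftFittingNull {x : L} {m : M} :
    m ∈ B.leftFittingNull x ↔ ∃ k : ℕ, (B.left x ^ k) m = 0 := by
  rw [leftFittingNull, Submodule.mem_iSup_of_directed]
  · simp
  · exact (Monotone.directed_le fun _ _ h => by
      obtain ⟨c, rfl⟩ := Nat.exists_eq_add_of_le h
      intro m hm
      rw [LinearMap.mem_ker] at hm ⊢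
      rw [add_comm, pow_add, Module.End.mul_apply, hm, map_zero])

theorem isSubbimodule_leftFittingNull [SMulCommClass F L L] {x : L}
    (hx : IsNilpotent (LinearMap.mulLeft F x)) : B.IsSubbimodule (B.leftFittingNull x) := by
  obtain ⟨j, hj⟩ := hx
  intro y m hm
  obtain ⟨k, hk⟩ := B.mem_leftFittingNull.1 hm
  have hy : (LinearMap.mulLeft F x ^ j) y = 0 := by rw [hj, LinearMap.zero_apply]
  exact ⟨B.mem_leftFittingNull.2 ⟨_, pow_apply_bilin_eq_zero B.left
      (fun u v => by simp [B.llm]) hy hk⟩,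
    B.mem_leftFittingNull.2 ⟨_, pow_apply_bilin_eq_zero B.right
      (fun u v => by simp [B.lml]) hy hk⟩⟩

attribute [local instance] LieRing.ofAssociativeRing

/-- Engel's theorem for the Lie algebra of left actions. -/
theorem exists_ne_zero_forall_left_eq_zero [FiniteDimensional F M] [Nontrivial M]
    (h : ∀ x, IsNilpotent (B.left x)) : ∃ m : M, m ≠ 0 ∧ ∀ x, B.left x m = 0 := by
  let K : LieSubalgebra F (Module.End F M) :=
    { LinearMap.range B.left with
      lie_mem' := by
        rintro _ _ ⟨x, rfl⟩ ⟨y, rfl⟩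
        exact ⟨x * y, LinearMap.ext fun m => B.llm x y m⟩ }
  have hK : LieModule.IsNilpotent K M := by
    refine (LieModule.isNilpotent_iff_forall' (R := F)).2 ?_
    rintro ⟨_, x, rfl⟩
    exact h x
  obtain ⟨⟨m, hm⟩, hne⟩ := @exists_ne _ (LieModule.nontrivial_max_triv_of_isNilpotent F K M) 0
  refine ⟨m, fun h0 => hne (Subtype.ext h0), fun x => ?_⟩
  exact (LieModule.mem_maxTrivSubmodule F K M m).1 hm ⟨B.left x, x, rfl⟩

/-- Some element acts injectively from the left on a non-trivial irreducible bimodule: otherwise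
all left actions are nilpotent, and the common kernel provided by Engel's theorem is everything. -/
theorem exists_injective_left_of_irreducible [SMulCommClass F L L] [FiniteDimensional F M]
    (hL : ∀ x : L, IsNilpotent (LinearMap.mulLeft F x))
    (hirr : ∀ N : Submodule F M, B.IsSubbimodule N → N = ⊥ ∨ N = ⊤) (hB : ¬ B.IsTrivial) :
    ∃ x : L, Function.Injective (B.left x) := by
  by_contra! hinj
  have hnil : ∀ x, IsNilpotent (B.left x) := by
    intro x
    rcases hirr _ (B.isSubbimodule_leftFittingNull (hL x)) with h | h
    · refine absurd ((injective_iff_map_eq_zero _).2 fun m hm => ?_) (hinj x)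
      rw [← Submodule.mem_bot F, ← h]
      exact B.mem_leftFittingNull.2 ⟨1, by simpa using hm⟩
    · refine Module.End.isNilpotent_iff_of_finite.2 fun m => ?_
      exact B.mem_leftFittingNull.1 (h ▸ Submodule.mem_top)
  -- An irreducible bimodule is symmetric or anti-symmetric.
  have hright : (∀ x m, B.right x m = -B.left x m) ∨ ∀ x m, B.right x m = 0 := by
    rcases hirr _ B.isSubbimodule_antisymmetricKernel with h | h
    · refine Or.inl fun x m => ?_
      have := B.left_add_right_mem_antisymmetricKernel x m
      rw [h, Submodule.mem_bot] at this
      exact eq_neg_of_add_eq_zero_right this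
    · exact Or.inr fun x m =>
        B.right_eq_zero_of_mem_antisymmetricKernel x (h ▸ Submodule.mem_top)
  have hrz : ∀ {m}, (∀ x, B.left x m = 0) → ∀ x, B.right x m = 0 := fun {m} hm x => by
    rcases hright with h | h
    · rw [h, hm, neg_zero]
    · exact h x m
  have : Nontrivial M := by
    by_contra hM
    rw [not_nontrivial_iff_subsingleton] at hM
    exact hB fun x m => ⟨Subsingleton.elim _ _, Subsingleton.elim _ _⟩
  obtain ⟨m, hm0, hm⟩ := B.exists_ne_zero_forall_left_eq_zero hnil
  have hN : B.IsSubbimodule (⨅ x, LinearMap.ker (B.left x)) := by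
    intro x n hn
    have hn' : ∀ x, B.left x n = 0 := by simpa using hn
    rw [hn', hrz hn']
    exact ⟨zero_mem _, zero_mem _⟩
  rcases hirr _ hN with h | h
  · refine hm0 ?_
    rw [← Submodule.mem_bot F, ← h]
    simpa using hm
  · have hall : ∀ n x, B.left x n = 0 := fun n => by
      simpa using (h ▸ Submodule.mem_top : n ∈ ⨅ x, LinearMap.ker (B.left x))
    exact hB fun x n => ⟨hall n x, hrz (hall n) x⟩

end Irreducible

/-! ### Composition series -/

section CompositionSeries

variable {F L M : Type*} [Field F] [NonUnitalNonAssocRing L] [Module F L]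
  [AddCommGroup M] [Module F M] (B : LeibnizBimodule F L M)

theorem exists_compositionSeries [FiniteDimensional F M] :
    ∃ s : CompositionSeries B.subbimodules,
      (s.head : Submodule F M) = ⊥ ∧ (s.last : Submodule F M) = ⊤ := by
  have : Nonempty B.subbimodules := ⟨⟨⊤, fun _ _ _ => ⟨trivial, trivial⟩⟩⟩
  have hval : StrictMono (Subtype.val : B.subbimodules → Submodule F M) := fun _ _ h => h
  have : WellFoundedLT B.subbimodules := hval.wellFoundedLT
  have : WellFoundedGT B.subbimodules := hval.wellFoundedGT
  obtain ⟨f, f0, n, hn, hcov⟩ :=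
    exists_covBy_seq_of_wellFoundedLT_wellFoundedGT B.subbimodules
  refine ⟨⟨n, fun i => f i, fun i => hcov i i.2⟩, ?_, ?_⟩
  · have hbot : B.IsSubbimodule ⊥ := fun x m hm => by simp [(Submodule.mem_bot F).1 hm]
    exact le_bot_iff.1 (f0 (b := ⟨⊥, hbot⟩) (bot_le (a := (f 0 : Submodule F M))))
  · have htop : B.IsSubbimodule ⊤ := fun _ _ _ => ⟨trivial, trivial⟩
    exact top_le_iff.1 (hn (b := ⟨⊤, htop⟩) (le_top (a := (f n : Submodule F M))))

theorem subquotient_irreducible {N₁ N₂ : B.subbimodules} (h : N₁ ⋖ N₂)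
    (P : Submodule F ((N₂ : Submodule F M) ⧸
      (N₁ : Submodule F M).submoduleOf (N₂ : Submodule F M)))
    (hP : (B.subquotient N₁ N₂).IsSubbimodule P) : P = ⊥ ∨ P = ⊤ := by
  let Q := (N₁ : Submodule F M).submoduleOf (N₂ : Submodule F M)
  let N : B.subbimodules := ⟨(P.comap Q.mkQ).map (N₂ : Submodule F M).subtype, by
    rintro x _ ⟨m, hm, rfl⟩
    exact ⟨⟨(B.restrict N₂.2).left x m, (hP x _ hm).1, rfl⟩,
      ⟨(B.restrict N₂.2).right x m, (hP x _ hm).2, rfl⟩⟩⟩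
  have hmem : ∀ m : (N₂ : Submodule F M), (m : M) ∈ (N : Submodule F M) ↔ Q.mkQ m ∈ P := by
    intro m
    constructor
    · rintro ⟨m', hm', he⟩
      obtain rfl : m' = m := Subtype.ext he
      exact hm'
    · exact fun hm => ⟨m, hm, rfl⟩
  have h₁ : N₁ ≤ N := fun m hm => (hmem ⟨m, h.le hm⟩).2 (by
    have h0 : Q.mkQ ⟨m, h.le hm⟩ = 0 := (Submodule.Quotient.mk_eq_zero Q).2 hm
    exact h0 ▸ zero_mem P)
  have h₂ : N ≤ N₂ := by
    rintro _ ⟨m, _, rfl⟩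
    exact m.2
  rcases h.eq_or_eq h₁ h₂ with he | he
  · refine Or.inl ((Submodule.eq_bot_iff P).2 fun p hp => ?_)
    obtain ⟨m, rfl⟩ := Q.mkQ_surjective p
    have := (hmem m).2 hp
    rw [he] at this
    exact (Submodule.Quotient.mk_eq_zero Q).2 this
  · refine Or.inr (Submodule.eq_top_iff'.2 fun p => ?_)
    obtain ⟨m, rfl⟩ := Q.mkQ_surjective p
    exact (hmem m).1 (by rw [he]; exact m.2)

/-- On a non-trivial composition factor `N₂ / N₁` some element of `L` acts from the left without
generalized null vectors. -/
theorem exists_left_pow_mem_imp_mem [SMulCommClass F L L] [FiniteDimensional F M]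
    (hL : ∀ x : L, IsNilpotent (LinearMap.mulLeft F x)) {N₁ N₂ : B.subbimodules} (h : N₁ ⋖ N₂)
    (hB : ¬ (B.subquotient N₁ N₂).IsTrivial) :
    ∃ x : L, ∀ m ∈ (N₂ : Submodule F M), ∀ k : ℕ,
      (B.left x ^ k) m ∈ (N₁ : Submodule F M) → m ∈ (N₁ : Submodule F M) := by
  obtain ⟨x, hx⟩ := (B.subquotient N₁ N₂).exists_injective_left_of_irreducible hL
    (fun P hP => B.subquotient_irreducible h P hP) hB
  refine ⟨x, fun m hm k => ?_⟩
  induction k generalizing m with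
  | zero => exact id
  | succ k ih =>
    rw [pow_succ, Module.End.mul_apply]
    intro hk
    have h₁ := ih _ (N₂.2 x m hm).1 hk
    let Q := (N₁ : Submodule F M).submoduleOf (N₂ : Submodule F M)
    have h₂ : Q.mkQ ⟨m, hm⟩ = 0 := hx (by
      rw [map_zero]
      exact (Submodule.Quotient.mk_eq_zero Q).2 h₁)
    exact (Submodule.Quotient.mk_eq_zero Q).1 h₂

end CompositionSeries

/-! ### Lie derivatives and composition factors -/

section Vanishing

variable {F L M : Type*} [Field F] [NonUnitalNonAssocRing L] [Module F L]
  [AddCommGroup M] [Module F M]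

/-- The cochains with values in the subspace `N`. -/
def cochainsInto (n : ℕ) (N : Submodule F M) : Submodule F (Cochain F L M n) where
  carrier := {f | ∀ v, f v ∈ N}
  add_mem' hf hg v := N.add_mem (hf v) (hg v)
  zero_mem' _ := N.zero_mem
  smul_mem' c _ hf v := N.smul_mem c (hf v)

theorem nonempty_cochainsInto_zero_equiv (N : Submodule F M) :
    Nonempty ((cochainsInto 0 N : Submodule F (Cochain F L M 0)) ≃ₗ[F] N) := by
  let e : M ≃ₗ[F] Cochain F L M 0 :=
    MultilinearMap.constLinearEquivOfIsEmpty F F (fun _ : Fin 0 => L) M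
  refine ⟨(e.ofSubmodules N (cochainsInto 0 N) (le_antisymm ?_ fun f hf => ?_)).symm⟩
  · rintro _ ⟨m, hm, rfl⟩
    exact fun _ => hm
  · refine ⟨f 0, hf 0, MultilinearMap.ext fun v => ?_⟩
    exact congrArg f (Subsingleton.elim 0 v)

variable [SMulCommClass F L L] (B : LeibnizBimodule F L M)

theorem lieDeriv_mem_cochainsInto {n : ℕ} {N : Submodule F M} (hN : B.IsSubbimodule N) (x : L)
    {f : Cochain F L M n} (hf : f ∈ cochainsInto n N) :
    B.lieDeriv x n f ∈ cochainsInto n N := fun v => by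
  rw [lieDeriv_apply]
  exact N.sub_mem (hN x _ (hf v)).1 (N.sum_mem fun j _ => hf _)

/-- As left multiplication by `x` is nilpotent, the values of a generalized null vector of `θₓ` are
generalized null vectors of the left action of `x`. -/
theorem exists_left_pow_apply_eq_zero {x : L} (hx : IsNilpotent (LinearMap.mulLeft F x)) {n k : ℕ}
    {f : Cochain F L M n} (hf : (B.lieDeriv x n ^ k) f = 0) (v : Fin n → L) :
    ∃ l : ℕ, (B.left x ^ l) (f v) = 0 := by
  induction n generalizing k with
  | zero =>
    have h : ∀ (k : ℕ), ((B.lieDeriv x 0 ^ k) f) v = (B.left x ^ k) (f v) := fun k => by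
      induction k with
      | zero => rfl
      | succ k ih => rw [pow_succ', Module.End.mul_apply, lieDeriv_zero_apply, ih, pow_succ',
          Module.End.mul_apply]
    exact ⟨k, by rw [← h, hf]; rfl⟩
  | succ n ih =>
    obtain ⟨j, hj⟩ := hx
    have hy : (LinearMap.mulLeft F x ^ j) (v 0) = 0 := by rw [hj, LinearMap.zero_apply]
    have h := ih (pow_apply_bilin_eq_zero (R := B.lieDeriv x n) (contract n)
      (fun y g => by simp [contract_lieDeriv]) hy hf) (Fin.tail v)
    rwa [contract_apply, Fin.cons_self_tail] at h

/-- If no composition factor of `M` is trivial, then a space of cochains that the Lie derivatives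
preserve is contained in every space into which they map it. -/
theorem le_of_lieDeriv_mem [FiniteDimensional F L] [FiniteDimensional F M]
    (hL : ∀ x : L, IsNilpotent (LinearMap.mulLeft F x)) (hM : B.CompositionFactorsNontrivial)
    {n : ℕ} {Z Y : Submodule F (Cochain F L M n)} (hZ : ∀ x, ∀ f ∈ Z, B.lieDeriv x n f ∈ Z)
    (hY : ∀ x, ∀ f ∈ Z, B.lieDeriv x n f ∈ Y) : Z ≤ Y := by
  obtain ⟨s, h0, h1⟩ := B.exists_compositionSeries
  suffices h : ∀ i, Z ⊓ cochainsInto n (s i : Submodule F M) ≤ Y from fun f hf =>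
    h (Fin.last _) ⟨hf, fun v => by
      change f v ∈ (s.last : Submodule F M)
      rw [h1]
      trivial⟩
  intro i
  induction i using Fin.induction with
  | zero =>
    rintro f ⟨-, hf⟩
    have hf0 : f = 0 := MultilinearMap.ext fun v => by
      have : f v ∈ (s.head : Submodule F M) := hf v
      rwa [h0] at this
    exact hf0 ▸ zero_mem Y
  | succ i ih =>
    intro f hf
    obtain ⟨x, hx⟩ := B.exists_left_pow_mem_imp_mem hL (s.step i) (hM s h0 h1 i)
    have hinv : ∀ g ∈ Z ⊓ cochainsInto n (s i.succ : Submodule F M),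
        B.lieDeriv x n g ∈ Z ⊓ cochainsInto n (s i.succ : Submodule F M) := fun g hg =>
      ⟨hZ x g hg.1, B.lieDeriv_mem_cochainsInto (s i.succ).2 x hg.2⟩
    obtain ⟨g, hg, k, hk⟩ := exists_pow_apply_sub_eq_zero (B.lieDeriv x n) hinv hf
    have hfg := sub_mem hf (hinv g hg)
    have hlow : f - B.lieDeriv x n g ∈ cochainsInto n (s i.castSucc : Submodule F M) := fun v => by
      obtain ⟨l, hl⟩ := B.exists_left_pow_apply_eq_zero (hL x) hk v
      exact hx _ (hfg.2 v) l (hl ▸ zero_mem _)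
    have hsum := Y.add_mem (ih ⟨hfg.1, hlow⟩) (hY x g hg.1)
    rwa [sub_add_cancel] at hsum

end Vanishing

end LeibnizBimodule

/-- In a nilpotent algebra the left multiplications are nilpotent. -/
theorem IsNilpotentAlgebra.isNilpotent_mulLeft {F L : Type*} [Field F] [NonUnitalNonAssocRing L]
    [Module F L] [SMulCommClass F L L] (hL : IsNilpotentAlgebra L) (x : L) :
    IsNilpotent (LinearMap.mulLeft F x) := by
  obtain ⟨n, hn, h⟩ := hL
  -- The `k`-th power of the left multiplication by `x` takes `y` to the product `x (x (⋯ (x y)))`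
  -- of `k + 1` elements.
  have key : ∀ (k : ℕ) (y : L), ∃ w : FreeMagma L, w.length = k + 1 ∧
      FreeMagma.lift (id : L → L) w = (LinearMap.mulLeft F x ^ k) y := by
    intro k y
    induction k with
    | zero => exact ⟨FreeMagma.of y, rfl, rfl⟩
    | succ k ih =>
      obtain ⟨w, hw, he⟩ := ih
      refine ⟨FreeMagma.of x * w, ?_, ?_⟩
      · change 1 + w.length = _
        rw [hw, add_comm]
      · rw [map_mul, he, pow_succ', Module.End.mul_apply]
        rfl
  refine ⟨n - 1, LinearMap.ext fun y => ?_⟩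
  obtain ⟨w, hw, he⟩ := key (n - 1) y
  rw [← he, h w (by omega), LinearMap.zero_apply]

/-! ### Cohomology -/

namespace LeibnizBimodule

variable {F L M : Type*} [Field F] [NonUnitalNonAssocRing L] [Module F L]
  [IsScalarTower F L L] [SMulCommClass F L L] [AddCommGroup M] [Module F M]
  (B : LeibnizBimodule F L M)

theorem subsingleton_HL_of_le {n : ℕ} (h : B.cocycles n ≤ B.coboundaries n) :
    Subsingleton (B.HL n) :=
  Submodule.Quotient.subsingleton_iff.2 (Submodule.submoduleOf_eq_top.2 h)

theorem mem_cocycles_zero {f : Cochain F L M 0} :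
    f ∈ B.cocycles 0 ↔ ∀ (x : L) (v : Fin 0 → L), B.right x (f v) = 0 := by
  rw [cocycles, LinearMap.mem_ker]
  constructor
  · intro h x v
    have := congrArg (fun e : Cochain F L M 1 => e (fun _ => x)) h
    simp only [d_apply] at this
    rw [Subsingleton.elim v ((Fin.last 0).removeNth fun _ => x)]
    simpa using this
  · intro h
    ext v
    simp [d_apply, h]

/-- An invariant `m`, one with `m · x = 0` for all `x`, satisfies `x · m = x · m + m · x`, so that the
Lie derivatives map the `0`-cocycles into the anti-symmetric kernel. -/
theorem cocycles_zero_eq [IsLeftLeibniz L] [FiniteDimensional F L] [FiniteDimensional F M]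
    (hL : ∀ x : L, IsNilpotent (LinearMap.mulLeft F x)) (hM : B.CompositionFactorsNontrivial) :
    B.cocycles 0 = cochainsInto 0 B.antisymmetricKernel := by
  refine le_antisymm ?_ fun f hf => B.mem_cocycles_zero.2 fun x v =>
    B.right_eq_zero_of_mem_antisymmetricKernel x (hf v)
  refine B.le_of_lieDeriv_mem hL hM (fun x f hf => B.lieDeriv_mem_cocycles x hf)
    fun x f hf v => ?_
  have h := B.left_add_right_mem_antisymmetricKernel x (f v)
  rwa [B.mem_cocycles_zero.1 hf, add_zero] at h

theorem cocycles_le_coboundaries [IsLeftLeibniz L] [FiniteDimensional F L] [FiniteDimensional F M]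
    (hL : ∀ x : L, IsNilpotent (LinearMap.mulLeft F x)) (hM : B.CompositionFactorsNontrivial)
    {n : ℕ} : B.cocycles (n + 1) ≤ B.coboundaries (n + 1) :=
  B.le_of_lieDeriv_mem hL hM (fun x _ hf => B.lieDeriv_mem_cocycles x hf)
    fun x _ hf => B.lieDeriv_mem_coboundaries x hf

end LeibnizBimodule

theorem theorem4p2 {F L M : Type*} [Field F] [NonUnitalNonAssocRing L] [Module F L]
    [IsScalarTower F L L] [SMulCommClass F L L] [IsLeftLeibniz L] [FiniteDimensional F L]
    (hL : IsNilpotentAlgebra L)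
    [AddCommGroup M] [Module F M] [FiniteDimensional F M] (B : LeibnizBimodule F L M)
    (hM : B.CompositionFactorsNontrivial) :
    (Nonempty (B.HL 0 ≃ₗ[F] B.antisymmetricKernel) ∧
      ∀ n : ℕ, 1 ≤ n → Subsingleton (B.HL n)) ∧
    (B.IsSymmetric → ∀ n : ℕ, Subsingleton (B.HL n)) := by
  have hL' : ∀ x : L, IsNilpotent (LinearMap.mulLeft F x) := hL.isNilpotent_mulLeft
  have hpos : ∀ n : ℕ, 1 ≤ n → Subsingleton (B.HL n) := fun n hn => by
    obtain ⟨n, rfl⟩ := Nat.exists_eq_add_of_le' hn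
    exact B.subsingleton_HL_of_le (B.cocycles_le_coboundaries hL' hM)
  have hzero : Nonempty (B.HL 0 ≃ₗ[F] B.antisymmetricKernel) := by
    have hbot : (B.coboundaries 0).submoduleOf (B.cocycles 0) = ⊥ :=
      (Submodule.comap_bot _).trans (Submodule.ker_subtype _)
    obtain ⟨e⟩ := LeibnizBimodule.nonempty_cochainsInto_zero_equiv (L := L) B.antisymmetricKernel
    exact ⟨Submodule.quotEquivOfEqBot _ hbot ≪≫ₗ
      LinearEquiv.ofEq _ _ (B.cocycles_zero_eq hL' hM) ≪≫ₗ e⟩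
  refine ⟨⟨hzero, hpos⟩, fun hs n => ?_⟩
  rcases Nat.eq_zero_or_pos n with rfl | hn
  · obtain ⟨e⟩ := hzero
    rw [hs.antisymmetricKernel_eq_bot] at e
    exact e.toEquiv.subsingleton
  · exact hpos n hn
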